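/- Let $n\ge 1$ and let $K=[a_1,b_1]\times\dots\times[a_n,b_n]\subseteq\mathbb{R}^n$ with $a_i<b_i$ for all $i$. Write $\mathbf{x}^\alpha=\prod_i x_i^{\alpha_i}$, $\mathbf{x}^\alpha_{\min}=\min_{\mathbf{x}\in K}\mathbf{x}^\alpha$ and $\mathbf{x}^\alpha_{\max}=\max_{\mathbf{x}\in K}\mathbf{x}^\alpha$ for $\alpha\in\mathbb{N}^n$. Let $B\subseteq\mathbb{N}^n$ be finite and nonempty, let $k\ge 1$, and let $\Gamma=(\gamma^1,\dots,\gamma^k)\in\mathbb{N}^{n\times k}$ have columns $\gamma^i\in B\setminus\{\mathbf{0}\}$ with pairwise disjoint supports. Put $$\operatorname{TS}=(\gamma^1\mathbb{N}+\dots+\gamma^k\mathbb{N})\cap B,\qquad \deg(\operatorname{TS})=\max\{\|\alpha\|_1:\alpha\in \operatorname{TS}\},$$ $$\tilde P=\{\omega\in\mathbb{N}^k:\Gamma\omega\in\operatorname{TS}\},\qquad \tilde K=\prod_{i=1}^k[\mathbf{x}^{\gamma^i}_{\min},\mathbf{x}^{\gamma^i}_{\max}],$$ and, for $\mathbf{c}\in\mathbb{R}^{\operatorname{TS}}$,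 let $p_{\mathbf{c}}(\tilde{\mathbf{x}})=\sum_{\omega\in\tilde P}\mathbf{c}_{\Gamma\omega}\tilde{\mathbf{x}}^\omega\in\mathbb{R}[\tilde x_1,\dots,\tilde x_k]$. Fix $\mathbf{v}\in\mathbb{R}^{\operatorname{TS}}$. The truncated submonoid separation problem is $$\text{(SP)}\qquad\max\ \delta-\langle\mathbf{c},\mathbf{v}\rangle\quad\text{over }\mathbf{c}\in\mathbb{R}^{\operatorname{TS}},\ \delta\in\mathbb{R}\quad\text{s.t. } p_{\mathbf{c}}(\tilde{\mathbf{x}})\ge\delta\ \ \forall\,\tilde{\mathbf{x}}\in\tilde K,\quad \mathbf{c}_\beta\in[-1,1]\ \ \forall\,\beta\in\operatorname{TS}.$$ Let $g_i(\tilde{\mathbf{x}})=(\mathbf{x}^{\gamma^i}_{\max}-\tilde x_i)(\tilde x_i-\mathbf{x}^{\gamma^i}_{\min})$ for $i=1,\dots,k$, and let $\Sigma_{k,d}$ be the set of sums of squares of polynomials in $\mathbb{R}[\tilde x_1,\dots,\tilde x_k]$ that have degree at most $d$. For every even integer $d\ge\deg(\operatorname{TS})$ consider $$(\text{SOS}_d)\qquad\max\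 \delta-\langle\mathbf{c},\mathbf{v}\rangle\quad\text{over }\mathbf{c}\in\mathbb{R}^{\operatorname{TS}},\ \delta\in\mathbb{R},\ \sigma_0\in\Sigma_{k,d},\ \sigma_1,\dots,\sigma_k\in\Sigma_{k,d-2}$$ $$\text{s.t. } p_{\mathbf{c}}-\delta=\sigma_0+\sum_{i=1}^k\sigma_ig_i,\quad \mathbf{c}_\beta\in[-1,1]\ \ \forall\,\beta\in\operatorname{TS}.$$ Then the following hold. (a) For every even $d\ge\deg(\operatorname{TS})$, if $(\mathbf{c},\delta,\sigma_0,\dots,\sigma_k)$ is feasible for $(\text{SOS}_d)$, then $(\mathbf{c},\delta)$ is feasible for (SP). (b) (SP) has an optimal solution, and so does $(\text{SOS}_d)$ for every even $d\ge\deg(\operatorname{TS})$. As $d\to\infty$ along the even integers, the optimal solutions of $(\text{SOS}_d)$ converge to those of (SP): for any choice of optimal solutions $(\mathbf{c}^{(d)},\delta^{(d)},\sigma^{(d)}_0,\dots,\sigma^{(d)}_k)$ of $(\text{SOS}_d)$, the distance of $(\mathbf{c}^{(d)},\delta^{(d)})$ to the set of optimal solutions of (SP) tends to $0$ (so $(\mathbf{c}^{(d)},\delta^{(d)})$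 converges to the optimal solution of (SP) if that is unique), and the optimal value of $(\text{SOS}_d)$ tends to the optimal value of (SP). -/

import Mathlib

open Filter Topology

namespace MonomialPattern

noncomputable section

/-! ### Exponents, monomials over a box -/

/-- The monomial `x ^ α = ∏ i, x i ^ α i`. -/
def mono {n : ℕ} (α : Fin n → ℕ) (x : Fin n → ℝ) : ℝ := ∏ i, x i ^ α i

/-- The minimum of the monomial `x ^ α` over the box `K = [a, b]`. -/
def monoMin {n : ℕ} (a b : Fin n → ℝ) (α : Fin n → ℕ) : ℝ := sInf (mono α '' Set.Icc a b)

/-- The maximum of the monomial `x ^ α` over the box `K = [a, b]`. -/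
def monoMax {n : ℕ} (a b : Fin n → ℝ) (α : Fin n → ℕ) : ℝ := sSup (mono α '' Set.Icc a b)

theorem continuous_mono {n : ℕ} (α : Fin n → ℕ) : Continuous (mono α) := by
  unfold mono; fun_prop

theorem isLeast_monoMin {n : ℕ} {a b : Fin n → ℝ} (hab : ∀ i, a i < b i) (α : Fin n → ℕ) :
    IsLeast (mono α '' Set.Icc a b) (monoMin a b α) :=
  (isCompact_Icc.image (continuous_mono α)).isLeast_sInf
    ((Set.nonempty_Icc.2 fun i => (hab i).le).image _)

theorem isGreatest_monoMax {n : ℕ} {a b : Fin n → ℝ} (hab : ∀ i, a i < b i) (α : Fin n → ℕ) :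
    IsGreatest (mono α '' Set.Icc a b) (monoMax a b α) :=
  (isCompact_Icc.image (continuous_mono α)).isGreatest_sSup
    ((Set.nonempty_Icc.2 fun i => (hab i).le).image _)

/-- The degree `max {‖α‖₁ : α ∈ P}` of a finite set of exponents. -/
def degSet {n : ℕ} (P : Finset (Fin n → ℕ)) : ℕ := P.sup fun α => ∑ i, α i

/-! ### The truncated submonoid pattern -/

/-- `Λ⁺(Γ)`: the submonoid of `ℕⁿ` generated by the columns of `Γ`. -/
def submonoid {n k : ℕ} (Γ : Matrix (Fin n) (Fin k) ℕ) : AddSubmonoid (Fin n → ℕ) :=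
  AddSubmonoid.closure (Set.range Γ.col)

open Classical in
/-- The `B`-truncated submonoid pattern `TS(Γ, B) = Λ⁺(Γ) ∩ B`. -/
def TS {n k : ℕ} (Γ : Matrix (Fin n) (Fin k) ℕ) (B : Finset (Fin n → ℕ)) :
    Finset (Fin n → ℕ) :=
  {α ∈ B | α ∈ submonoid Γ}

theorem mem_TS {n k : ℕ} {Γ : Matrix (Fin n) (Fin k) ℕ} {B : Finset (Fin n → ℕ)}
    {α : Fin n → ℕ} : α ∈ TS Γ B ↔ α ∈ submonoid Γ ∧ α ∈ B := by
  simp [TS, and_comm]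

/-- The reduced pattern `P̃ = {ω ∈ ℕᵏ : Γ ω ∈ TS(Γ, B)}`. -/
def tildeP {n k : ℕ} (Γ : Matrix (Fin n) (Fin k) ℕ) (B : Finset (Fin n → ℕ)) :
    Set (Fin k → ℕ) :=
  {ω | Γ.mulVec ω ∈ TS Γ B}

/-- The reduced box `K̃`, the product of the intervals `[x^{γʲ}_min, x^{γʲ}_max]`. -/
def tildeK {n k : ℕ} (a b : Fin n → ℝ) (Γ : Matrix (Fin n) (Fin k) ℕ) : Set (Fin k → ℝ) :=
  Set.Icc (fun j => monoMin a b (Γ.col j)) (fun j => monoMax a b (Γ.col j))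

/-- The reduced pattern is finite, so that the sum in `pPoly` is a genuine finite sum. -/
theorem tildeP_finite {n k : ℕ} {Γ : Matrix (Fin n) (Fin k) ℕ} (B : Finset (Fin n → ℕ))
    (h0 : ∀ j, Γ.col j ≠ 0) : (tildeP Γ B).Finite := by
  refine (Set.finite_Iic (fun _ : Fin k => degSet B)).subset fun ω hω j => ?_
  obtain ⟨i, hi⟩ := Function.ne_iff.1 (h0 j)
  have hB : Γ.mulVec ω ∈ B := (mem_TS.1 hω).2
  have h1 : ω j ≤ Γ i j * ω j :=
    Nat.le_mul_of_pos_left _ (Nat.pos_of_ne_zero hi)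
  have h2 : Γ i j * ω j ≤ Γ.mulVec ω i :=
    Finset.single_le_sum (f := fun j => Γ i j * ω j) (fun _ _ => Nat.zero_le _)
      (Finset.mem_univ j)
  have h3 : Γ.mulVec ω i ≤ ∑ i, Γ.mulVec ω i :=
    Finset.single_le_sum (f := Γ.mulVec ω) (fun _ _ => Nat.zero_le _) (Finset.mem_univ i)
  have h4 : ∑ i, Γ.mulVec ω i ≤ degSet B :=
    Finset.le_sup (f := fun α : Fin n → ℕ => ∑ i, α i) hB
  exact h1.trans (h2.trans (h3.trans h4))

/-- The `k`-variate polynomial `p_c = ∑_{ω ∈ P̃} c_{Γ ω} x̃ ^ ω`. -/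
def pPoly {n k : ℕ} {Γ : Matrix (Fin n) (Fin k) ℕ} {B : Finset (Fin n → ℕ)}
    (c : TS Γ B → ℝ) : MvPolynomial (Fin k) ℝ :=
  ∑ᶠ ω : tildeP Γ B,
    MvPolynomial.monomial (Finsupp.equivFunOnFinite.symm ω.1) (c ⟨Γ.mulVec ω.1, ω.2⟩)

/-! ### The two optimization problems -/

/-- The cone `Σ_{k,d}` of `k`-variate sums of squares of degree at most `d`. -/
def SOS (k d : ℕ) : Set (MvPolynomial (Fin k) ℝ) := {σ | IsSumSq σ ∧ σ.totalDegree ≤ d}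

/-- The box constraint polynomial `g_j = (x^{γʲ}_max - x̃_j) (x̃_j - x^{γʲ}_min)`. -/
def gPoly {n k : ℕ} (a b : Fin n → ℝ) (Γ : Matrix (Fin n) (Fin k) ℕ) (j : Fin k) :
    MvPolynomial (Fin k) ℝ :=
  (MvPolynomial.C (monoMax a b (Γ.col j)) - MvPolynomial.X j) *
    (MvPolynomial.X j - MvPolynomial.C (monoMin a b (Γ.col j)))

/-- The pairs `(c, δ)`. -/
abbrev Cut {n k : ℕ} (Γ : Matrix (Fin n) (Fin k) ℕ) (B : Finset (Fin n → ℕ)) : Type :=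
  (TS Γ B → ℝ) × ℝ

/-- The tuples `((c, δ), σ₀, (σ₁, …, σ_k))`. -/
abbrev CutSOS {n k : ℕ} (Γ : Matrix (Fin n) (Fin k) ℕ) (B : Finset (Fin n → ℕ)) : Type :=
  Cut Γ B × MvPolynomial (Fin k) ℝ × (Fin k → MvPolynomial (Fin k) ℝ)

/-- The objective `δ - ⟨c, v⟩`. -/
def objective {n k : ℕ} {Γ : Matrix (Fin n) (Fin k) ℕ} {B : Finset (Fin n → ℕ)}
    (v : TS Γ B → ℝ) (z : Cut Γ B) : ℝ :=
  z.2 - ∑ β, z.1 β * v β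

/-- Feasible solutions `(c, δ)` of the truncated submonoid separation problem. -/
def feasTrunc {n k : ℕ} (a b : Fin n → ℝ) (Γ : Matrix (Fin n) (Fin k) ℕ)
    (B : Finset (Fin n → ℕ)) : Set (Cut Γ B) :=
  {z | (∀ x ∈ tildeK a b Γ, z.2 ≤ MvPolynomial.eval x (pPoly z.1)) ∧
    ∀ β, z.1 β ∈ Set.Icc (-1 : ℝ) 1}

/-- Feasible solutions `((c, δ), σ₀, (σ₁, …, σ_k))` of the SOS-constrained problem with degree
bound `d` (used for even `d ≥ deg TS(Γ, B) ≥ 1`, so that `d - 2` is the true difference). -/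
def feasSOS {n k : ℕ} (a b : Fin n → ℝ) (Γ : Matrix (Fin n) (Fin k) ℕ)
    (B : Finset (Fin n → ℕ)) (d : ℕ) : Set (CutSOS Γ B) :=
  {w | w.2.1 ∈ SOS k d ∧ (∀ j, w.2.2 j ∈ SOS k (d - 2)) ∧
    pPoly w.1.1 - MvPolynomial.C w.1.2 = w.2.1 + ∑ j, w.2.2 j * gPoly a b Γ j ∧
    ∀ β, w.1.1 β ∈ Set.Icc (-1 : ℝ) 1}

/-- Optimal solutions of the problem of maximizing `f` over `S`. -/
def optimal {α : Type*} (f : α → ℝ) (S : Set α) : Set α := {x | x ∈ S ∧ IsMaxOn f S x}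

/-- Optimal solutions of the truncated submonoid separation problem. -/
def optTrunc {n k : ℕ} (a b : Fin n → ℝ) (Γ : Matrix (Fin n) (Fin k) ℕ)
    (B : Finset (Fin n → ℕ)) (v : TS Γ B → ℝ) : Set (Cut Γ B) :=
  optimal (objective v) (feasTrunc a b Γ B)

/-- Optimal solutions of the SOS-constrained problem with degree bound `d`. -/
def optSOS {n k : ℕ} (a b : Fin n → ℝ) (Γ : Matrix (Fin n) (Fin k) ℕ)
    (B : Finset (Fin n → ℕ)) (v : TS Γ B → ℝ) (d : ℕ) : Set (CutSOS Γ B) :=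
  optimal (fun w => objective v w.1) (feasSOS a b Γ B d)

end

end MonomialPattern

open MonomialPattern

/-! Feasibility transfers because sums of squares, and the box polynomials on `tildeK`, are
nonnegative. Conversely, lowering `δ` by any `ε > 0` makes `p_c - δ` strictly positive on the box.
By Putinar's theorem (`mem_boxModule_of_pos`) it then has a certificate of some finite degree, so
the optimal values converge.

Putinar's theorem is proved algebraically. The quadratic module of the box is Archimedean, and its
closure is stable under products (`mul_mem_closure`). Hence Bernstein polynomials in the rescaled
coordinates form a partition of unity inside the closure (`exists_partition`). A polynomial is close
to its value at each grid point, up to an error governed by the squared distance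
(`exists_sub_eval_mem`). Averaging with these weights puts every polynomial nonnegative on the box
into the closure.

Optima exist by compactness. The zero solution has objective `0`, so only pairs with nonnegative
objective matter, and these form a compact set (`isCompact_goodTrunc`). The multipliers are
parametrized by Gram matrices, which are bounded because the box is full-dimensional
(`exists_norm_gram_le`). The same compact set turns convergence of values into convergence to the
optimal set (`tendsto_infDist_of_tendsto`). -/

namespace MonomialPattern

/-! ### Archimedean quadratic modules -/

section QuadraticModule

variable {R : Type*} [CommRing R] [Algebra ℝ R]

/-- An additive submonoid is a quadratic module if it contains `1` and is stable under
multiplication by squares. -/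
structure IsQuadModule (M : AddSubmonoid R) : Prop where
  one_mem : 1 ∈ M
  sq_mul_mem : ∀ s : R, ∀ p ∈ M, s ^ 2 * p ∈ M

/-- Every element is bounded in the order defined by the quadratic module `M`. -/
def IsArchModule (M : AddSubmonoid R) : Prop :=
  ∀ p : R, ∃ c : ℝ, algebraMap ℝ R c - p ∈ M

namespace IsQuadModule

variable {M : AddSubmonoid R} (hM : IsQuadModule M)

include hM

omit [Algebra ℝ R] in
theorem sq_mem (s : R) : s ^ 2 ∈ M := by
  simpa using hM.sq_mul_mem s 1 hM.one_mem

theorem const_mul_mem {c : ℝ} (hc : 0 ≤ c) {p : R} (hp : p ∈ M) :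
    algebraMap ℝ R c * p ∈ M := by
  have := hM.sq_mul_mem (algebraMap ℝ R (Real.sqrt c)) p hp
  rwa [← map_pow, Real.sq_sqrt hc] at this

theorem const_mem {c : ℝ} (hc : 0 ≤ c) : algebraMap ℝ R c ∈ M := by
  simpa using hM.const_mul_mem hc hM.one_mem

theorem add_const_mem {p : R} {c d : ℝ} (h : p + algebraMap ℝ R c ∈ M) (hcd : c ≤ d) :
    p + algebraMap ℝ R d ∈ M := by
  have := M.add_mem h (hM.const_mem (sub_nonneg.2 hcd))
  rw [map_sub] at this
  convert this using 1
  ring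

theorem const_sub_mem {p : R} {c d : ℝ} (h : algebraMap ℝ R c - p ∈ M) (hcd : c ≤ d) :
    algebraMap ℝ R d - p ∈ M := by
  have := hM.add_const_mem (p := -p) (c := c) (by rwa [neg_add_eq_sub]) hcd
  rwa [neg_add_eq_sub] at this

/-- A two-sided bound on `p` bounds `p ^ 2`. -/
theorem sq_bound {p : R} {c : ℝ} (hc : 0 < c) (h1 : algebraMap ℝ R c - p ∈ M)
    (h2 : algebraMap ℝ R c + p ∈ M) : algebraMap ℝ R (c ^ 2) - p ^ 2 ∈ M := by
  -- `(c - p)² (c + p) + (c + p)² (c - p) = 2c (c² - p²)`.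
  have h := hM.const_mul_mem (c := (2 * c)⁻¹) (by positivity)
    (M.add_mem (hM.sq_mul_mem (algebraMap ℝ R c - p) _ h2)
      (hM.sq_mul_mem (algebraMap ℝ R c + p) _ h1))
  have e : algebraMap ℝ R (2 * c)⁻¹ * (2 * algebraMap ℝ R c) = 1 := by
    rw [← map_ofNat (algebraMap ℝ R) 2, ← map_mul, ← map_mul, inv_mul_cancel₀ (by positivity),
      map_one]
  convert h using 1
  rw [map_pow]
  linear_combination -(algebraMap ℝ R c ^ 2 - p ^ 2) * e

theorem exists_sq_bound (hA : IsArchModule M) (p : R) :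
    ∃ c : ℝ, 0 < c ∧ algebraMap ℝ R c - p ^ 2 ∈ M := by
  obtain ⟨c, hc⟩ := hA (p ^ 2)
  exact ⟨max c 1, by positivity, hM.const_sub_mem hc (le_max_left _ _)⟩

/-- The closure of a quadratic module in the order topology defined by it. -/
def closure : AddSubmonoid R where
  carrier := {p | ∀ ε : ℝ, 0 < ε → p + algebraMap ℝ R ε ∈ M}
  zero_mem' := fun ε hε => by simpa using hM.const_mem hε.le
  add_mem' := fun {p q} hp hq ε hε => by
    have := M.add_mem (hp (ε / 2) (by positivity)) (hq (ε / 2) (by positivity))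
    have e : algebraMap ℝ R ε = algebraMap ℝ R (ε / 2) + algebraMap ℝ R (ε / 2) := by
      rw [← map_add, add_halves]
    rw [e]
    convert this using 1
    ring

theorem le_closure : M ≤ hM.closure := fun _ hp _ hε => M.add_mem hp (hM.const_mem hε.le)

theorem archModule_closure (hA : IsArchModule M) : IsArchModule hM.closure := fun p =>
  (hA p).imp fun _ h => hM.le_closure h

/-- If `c - s² ∈ M`, then `s² p + ε = s² (p + ε/c) + (ε/c)(c - s²)`; the Archimedean property is
what supplies `c`. -/
theorem isQuadModule_closure (hA : IsArchModule M) : IsQuadModule hM.closure where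
  one_mem := hM.le_closure hM.one_mem
  sq_mul_mem := fun s p hp ε hε => by
    obtain ⟨c, hc, hs⟩ := hM.exists_sq_bound hA s
    have h1 := hM.sq_mul_mem s _ (hp (ε / c) (by positivity))
    have h2 := hM.const_mul_mem (c := ε / c) (by positivity) hs
    have e : algebraMap ℝ R ε = algebraMap ℝ R (ε / c) * algebraMap ℝ R c := by
      rw [← map_mul, div_mul_cancel₀ _ hc.ne']
    convert M.add_mem h1 h2 using 1
    rw [e]
    ring

theorem closure_closure (hA : IsArchModule M) :
    (hM.isQuadModule_closure hA).closure = hM.closure := by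
  refine le_antisymm (fun p hp ε hε => ?_) (hM.isQuadModule_closure hA).le_closure
  have := hp (ε / 2) (by positivity) (ε / 2) (by positivity)
  rwa [add_assoc, ← map_add, add_halves] at this

omit [Algebra ℝ R] in
/-- The iteration `u ↦ u - u²`, by which `u` is approximated by sums of squares. -/
theorem iterate_mem {u : R} (hu : u ∈ M) (hu1 : 1 - u ∈ M) (n : ℕ) :
    ∃ r ∈ M, 1 - n * r ^ 2 ∈ M ∧ ∀ w ∈ M, u * w - r * w ∈ M := by
  -- The invariant `u - r - n r² ∈ M` survives the iteration. Adding `1 - u` and `r` to it gives `1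
  -- - n r²`.
  suffices ∃ r ∈ M, 1 - r ∈ M ∧ u - r - n * r ^ 2 ∈ M ∧ ∀ w ∈ M, u * w - r * w ∈ M by
    obtain ⟨r, h1, h2, h3, h4⟩ := this
    refine ⟨r, h1, ?_, h4⟩
    convert M.add_mem (M.add_mem hu1 h1) h3 using 1
    ring
  induction n with
  | zero => exact ⟨u, hu, hu1, by simp, fun w _ => by simp⟩
  | succ n ih =>
    obtain ⟨r, h1, h2, h3, h4⟩ := ih
    -- `r - r² = r² (1 - r) + (1 - r)² r`.
    have h5 : r - r ^ 2 ∈ M := by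
      convert M.add_mem (hM.sq_mul_mem r _ h2) (hM.sq_mul_mem (1 - r) _ h1) using 1
      ring
    refine ⟨r - r ^ 2, h5, ?_, ?_, fun w hw => ?_⟩
    · convert M.add_mem h2 (hM.sq_mem r) using 1
      ring
    -- The increment of the invariant is `n + 1` times `r² - (r - r²)² = r² (r + (r - r²))`.
    · convert M.add_mem h3 (M.nsmul_mem (hM.sq_mul_mem r _ (M.add_mem h1 h5)) (n + 1)) using 1
      rw [nsmul_eq_mul]
      push_cast
      ring
    · convert M.add_mem (h4 w hw) (hM.sq_mul_mem r w hw) using 1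
      ring

/-- Replace `u` by a small `r` with `uw - rw ∈ M`. With `2ab = 1` and `tn = a²`, `uw + ε = (uw - rw)
+ (ar + bw)² + t(1 - n r²) + b²(c - w²) + (ε - t - b²c)`. Taking `b` small and then `n` large makes
the last constant nonnegative. -/
theorem mul_mem_closure_of_le_one (hA : IsArchModule M) {u w : R} (hu : u ∈ M)
    (hu1 : 1 - u ∈ M) (hw : w ∈ M) : u * w ∈ hM.closure := by
  intro ε hε
  obtain ⟨c, hc, hcw⟩ := hM.exists_sq_bound hA w
  set b : ℝ := Real.sqrt (ε / (2 * c)) with hb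
  have hb0 : 0 < b := Real.sqrt_pos.2 (by positivity)
  have hb2 : b ^ 2 * c = ε / 2 := by
    rw [hb, Real.sq_sqrt (by positivity)]
    field_simp
  set a : ℝ := (2 * b)⁻¹ with ha
  obtain ⟨n, hn⟩ := exists_nat_gt (a ^ 2 / (ε / 2))
  have hn0 : (0 : ℝ) < n := lt_of_le_of_lt (by positivity) hn
  set t : ℝ := a ^ 2 / n with ht
  have ht2 : t ≤ ε / 2 := by
    rw [ht, div_le_iff₀ hn0]
    rw [div_lt_iff₀ (by positivity)] at hn
    linarith
  obtain ⟨r, hr, hr1, hr2⟩ := hM.iterate_mem hu hu1 n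
  have h1 := hr2 w hw
  have h2 := hM.sq_mem (algebraMap ℝ R a * r + algebraMap ℝ R b * w)
  have h3 := hM.const_mul_mem (c := t) (by positivity) hr1
  have h4 := hM.const_mul_mem (c := b ^ 2) (by positivity) hcw
  have h5 := hM.const_mem (R := R) (c := ε - t - b ^ 2 * c) (by linarith)
  have e1 : 2 * (algebraMap ℝ R a * algebraMap ℝ R b) = 1 := by
    rw [← map_ofNat (algebraMap ℝ R) 2, ← map_mul, ← map_mul, ha, ← map_one (algebraMap ℝ R)]
    congr 1
    field_simp
  have e2 : algebraMap ℝ R t * n = algebraMap ℝ R a ^ 2 := by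
    rw [← map_natCast (algebraMap ℝ R) n, ← map_mul, ← map_pow, ht, div_mul_cancel₀ _ hn0.ne']
  convert M.add_mem (M.add_mem (M.add_mem h1 h2) (M.add_mem h3 h4)) h5 using 1
  simp only [map_sub, map_mul, map_pow]
  linear_combination (-r * w) * e1 + r ^ 2 * e2

theorem mul_mem_closure (hA : IsArchModule M) {u w : R} (hu : u ∈ M) (hw : w ∈ M) :
    u * w ∈ hM.closure := by
  obtain ⟨c, hc⟩ := hA u
  have hc' := hM.const_sub_mem hc (le_max_left c 1)
  set d := max c 1
  have hd : 0 < d := by positivity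
  have e : algebraMap ℝ R d * algebraMap ℝ R d⁻¹ = 1 := by
    rw [← map_mul, mul_inv_cancel₀ hd.ne', map_one]
  have h1 := hM.const_mul_mem (c := d⁻¹) (by positivity) hu
  have h2 := hM.const_mul_mem (c := d⁻¹) (by positivity) hc'
  have h3 := hM.mul_mem_closure_of_le_one hA h1
    (by convert h2 using 1; linear_combination -e) hw
  convert (hM.isQuadModule_closure hA).const_mul_mem hd.le h3 using 1
  linear_combination (-u * w) * e

/-- The closure of an Archimedean quadratic module is a preordering. -/
def preordering (hA : IsArchModule M) : Subsemiring R where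
  __ := hM.closure
  one_mem' := (hM.isQuadModule_closure hA).one_mem
  mul_mem' := fun {u w} hu hw => by
    -- Products of elements of the closure land in the closure of the closure, which is the closure
    -- again.
    have := (hM.isQuadModule_closure hA).mul_mem_closure (hM.archModule_closure hA) hu hw
    rwa [closure_closure hM hA] at this

theorem le_preordering (hA : IsArchModule M) {p : R} (hp : p ∈ M) : p ∈ hM.preordering hA :=
  hM.le_closure hp

/-- Elements that are bounded on both sides form a subalgebra. -/
def boundedSubalgebra : Subalgebra ℝ R where
  carrier := {p | ∃ c : ℝ, 0 < c ∧ algebraMap ℝ R c - p ∈ M ∧ algebraMap ℝ R c + p ∈ M}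
  algebraMap_mem' := fun r => ⟨|r| + 1, by positivity, by
    rw [← map_sub]; exact hM.const_mem (by linarith [le_abs_self r]), by
    rw [← map_add]; exact hM.const_mem (by linarith [neg_abs_le r])⟩
  add_mem' := by
    rintro p q ⟨c, hc, h1, h2⟩ ⟨d, hd, h3, h4⟩
    refine ⟨c + d, by positivity, ?_, ?_⟩
    · convert M.add_mem h1 h3 using 1
      rw [map_add]; ring
    · convert M.add_mem h2 h4 using 1
      rw [map_add]; ring
  mul_mem' := by
    rintro p q ⟨c, hc, h1, h2⟩ ⟨d, hd, h3, h4⟩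
    have h5 := hM.sq_bound hc h1 h2
    have h6 := hM.sq_bound hd h3 h4
    have e : algebraMap ℝ R 2⁻¹ * 2 = 1 := by
      rw [← map_ofNat (algebraMap ℝ R) 2, ← map_mul, inv_mul_cancel₀ two_ne_zero, map_one]
    -- `(c² - p²) + (d² - q²) + (p ∓ q)² = c² + d² ∓ 2pq` bounds the product on both sides.
    have h7 := hM.const_mul_mem (c := 2⁻¹) (by positivity)
      (M.add_mem (M.add_mem h5 h6) (hM.sq_mem (p - q)))
    have h8 := hM.const_mul_mem (c := 2⁻¹) (by positivity)
      (M.add_mem (M.add_mem h5 h6) (hM.sq_mem (p + q)))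
    refine ⟨2⁻¹ * (c ^ 2 + d ^ 2), by positivity, ?_, ?_⟩
    · convert h7 using 1
      rw [map_mul, map_add]
      linear_combination p * q * e
    · convert h8 using 1
      rw [map_mul, map_add]
      linear_combination -(p * q) * e

end IsQuadModule

end QuadraticModule

/-! ### Positive polynomials on a box -/

section Box

open MvPolynomial

variable {ι : Type*} [Fintype ι]

/-- The quadratic module generated by the polynomials `(hi j - X j) * (X j - lo j)`. -/
def boxModule (lo hi : ι → ℝ) : AddSubmonoid (MvPolynomial ι ℝ) where
  carrier := {p | ∃ (s : MvPolynomial ι ℝ) (t : ι → MvPolynomial ι ℝ), IsSumSq s ∧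
    (∀ j, IsSumSq (t j)) ∧ p = s + ∑ j, t j * ((C (hi j) - X j) * (X j - C (lo j)))}
  zero_mem' := ⟨0, 0, .zero, fun _ => .zero, by simp⟩
  add_mem' := by
    rintro _ _ ⟨s, t, hs, ht, rfl⟩ ⟨s', t', hs', ht', rfl⟩
    refine ⟨s + s', t + t', hs.add hs', fun j => (ht j).add (ht' j), ?_⟩
    simp only [Pi.add_apply, add_mul, Finset.sum_add_distrib]
    ring

variable (lo hi : ι → ℝ)

theorem isQuadModule_boxModule : IsQuadModule (boxModule lo hi) where
  one_mem := ⟨1, 0, .one, fun _ => .zero, by simp⟩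
  sq_mul_mem := by
    rintro q _ ⟨s, t, hs, ht, rfl⟩
    have hq : IsSumSq (q ^ 2) := by rw [sq]; exact .mul_self q
    refine ⟨q ^ 2 * s, fun j => q ^ 2 * t j, hq.mul hs, fun j => hq.mul (ht j), ?_⟩
    simp only [mul_add, Finset.mul_sum, mul_assoc]

theorem gen_mem_boxModule (j : ι) :
    (C (hi j) - X j) * (X j - C (lo j)) ∈ boxModule lo hi := by
  classical
  refine ⟨0, Pi.single j 1, .zero, fun i => ?_, ?_⟩
  · by_cases h : i = j
    · subst h; simp
    · simp [h]
  · rw [Finset.sum_eq_single j] <;> simp +contextual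

variable {lo hi}

/-- The quadratic generators already yield the linear ones: `(X - lo)² + (hi - X)(X - lo) = (hi -
lo)(X - lo)`. -/
theorem X_sub_mem_boxModule (h : ∀ j, lo j < hi j) (j : ι) :
    X j - C (lo j) ∈ boxModule lo hi := by
  have hM := isQuadModule_boxModule lo hi
  have hL : 0 < hi j - lo j := sub_pos.2 (h j)
  have e : (C (hi j - lo j)⁻¹ * (C (hi j) - C (lo j)) : MvPolynomial ι ℝ) = 1 := by
    rw [← C_sub, ← C_mul, inv_mul_cancel₀ hL.ne', C_1]
  have := hM.const_mul_mem (inv_nonneg.2 hL.le)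
    (add_mem (hM.sq_mem (X j - C (lo j))) (gen_mem_boxModule lo hi j))
  rw [algebraMap_eq] at this
  convert this using 1
  linear_combination (-(X j - C (lo j))) * e

theorem sub_X_mem_boxModule (h : ∀ j, lo j < hi j) (j : ι) :
    C (hi j) - X j ∈ boxModule lo hi := by
  have hM := isQuadModule_boxModule lo hi
  have hL : 0 < hi j - lo j := sub_pos.2 (h j)
  have e : (C (hi j - lo j)⁻¹ * (C (hi j) - C (lo j)) : MvPolynomial ι ℝ) = 1 := by
    rw [← C_sub, ← C_mul, inv_mul_cancel₀ hL.ne', C_1]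
  have := hM.const_mul_mem (inv_nonneg.2 hL.le)
    (add_mem (hM.sq_mem (C (hi j) - X j)) (gen_mem_boxModule lo hi j))
  rw [algebraMap_eq] at this
  convert this using 1
  linear_combination (-(C (hi j) - X j)) * e

/-- Bounded elements form a subalgebra, so it is enough to bound the variables. -/
theorem boundedSubalgebra_boxModule (h : ∀ j, lo j < hi j) :
    (isQuadModule_boxModule lo hi).boundedSubalgebra = ⊤ := by
  have hM := isQuadModule_boxModule lo hi
  rw [eq_top_iff, ← adjoin_range_X, Algebra.adjoin_le_iff]
  rintro _ ⟨j, rfl⟩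
  refine ⟨|lo j| + |hi j| + 1, by positivity, ?_, ?_⟩
  · refine hM.const_sub_mem (sub_X_mem_boxModule h j) ?_
    linarith [le_abs_self (hi j), abs_nonneg (lo j)]
  · rw [add_comm]
    refine hM.add_const_mem (c := -lo j) ?_ ?_
    · rw [map_neg, ← sub_eq_add_neg]
      exact X_sub_mem_boxModule h j
    · linarith [neg_le_abs (lo j), abs_nonneg (hi j)]

theorem exists_bound_boxModule (h : ∀ j, lo j < hi j) (p : MvPolynomial ι ℝ) :
    ∃ c : ℝ, 0 < c ∧ C c - p ∈ boxModule lo hi ∧ C c + p ∈ boxModule lo hi := by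
  have : p ∈ (isQuadModule_boxModule lo hi).boundedSubalgebra := by
    rw [boundedSubalgebra_boxModule h]; trivial
  exact this

theorem isArchModule_boxModule (h : ∀ j, lo j < hi j) : IsArchModule (boxModule lo hi) :=
  fun p => (exists_bound_boxModule h p).imp fun _ hc => hc.2.1

/-- Polynomials are, in the order of the quadratic module, uniformly continuous on the box. -/
theorem exists_sub_eval_mem (h : ∀ j, lo j < hi j) (f : MvPolynomial ι ℝ) :
    ∃ c : ℝ, 0 ≤ c ∧ ∀ l : ℝ, 0 < l → ∀ a ∈ Set.Icc lo hi,
      C (c * l⁻¹) + C (c * l) * ∑ i, (X i - C (a i)) ^ 2 + (f - C (eval a f)) ∈ boxModule lo hi ∧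
      C (c * l⁻¹) + C (c * l) * ∑ i, (X i - C (a i)) ^ 2 - (f - C (eval a f)) ∈
        boxModule lo hi := by
  have hM := isQuadModule_boxModule lo hi
  induction f using MvPolynomial.induction_on with
  | C r => exact ⟨0, le_rfl, fun l _ a _ => by simp⟩
  | add p q hp hq =>
    obtain ⟨c, hc, h1⟩ := hp
    obtain ⟨d, hd, h2⟩ := hq
    refine ⟨c + d, by positivity, fun l hl a ha => ?_⟩
    obtain ⟨h3, h4⟩ := h1 l hl a ha
    obtain ⟨h5, h6⟩ := h2 l hl a ha
    constructor
    · convert add_mem h3 h5 using 1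
      simp only [add_mul, C_add, eval_add]
      ring
    · convert add_mem h4 h6 using 1
      simp only [add_mul, C_add, eval_add]
      ring
  | mul_X p i hp =>
    obtain ⟨c, hc, h1⟩ := hp
    obtain ⟨b, hb, hb1, hb2⟩ := exists_bound_boxModule h p
    have hb3 := hM.sq_bound hb hb1 hb2
    set A : ℝ := |lo i| + |hi i| with hA
    have hA0 : 0 ≤ A := by positivity
    -- Leibniz splitting: `X_i p - a_i p(a) = (X_i - a_i) p + a_i (p - p(a))`. The two parts cost
    -- `b² l⁻¹ + l S` and `A c (l⁻¹ + l S)`; `h7` below pads the total to a common constant.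
    refine ⟨A * c + b ^ 2 + 1, by positivity, fun l hl a ha => ?_⟩
    obtain ⟨h3, h4⟩ := h1 l hl a ha
    have ha1 := ha.1 i
    have ha2 := ha.2 i
    have ha3 : |a i| ≤ A := by
      rw [abs_le]
      constructor
      · linarith [neg_abs_le (lo i), abs_nonneg (hi i)]
      · linarith [le_abs_self (hi i), abs_nonneg (lo i)]
    set S : MvPolynomial ι ℝ := ∑ i, (X i - C (a i)) ^ 2 with hS
    have hSi : S - (X i - C (a i)) ^ 2 ∈ boxModule lo hi := by
      classical
      rw [hS, ← Finset.add_sum_erase _ _ (Finset.mem_univ i), add_sub_cancel_left]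
      exact sum_mem fun j _ => hM.sq_mem _
    have hS0 : S ∈ boxModule lo hi := sum_mem fun j _ => hM.sq_mem _
    -- the contribution of `(X i - a i) * p`
    have h5 : ∀ s : ℝ, s ^ 2 = 1 → C (b ^ 2 * l⁻¹) + C l * S + C s * ((X i - C (a i)) * p) ∈
        boxModule lo hi := by
      intro s hs
      set t : ℝ := Real.sqrt l
      have ht : t ^ 2 = l := Real.sq_sqrt hl.le
      have ht0 : 0 < t := Real.sqrt_pos.2 hl
      have e1 : (C t * C t⁻¹ : MvPolynomial ι ℝ) = 1 := by
        rw [← C_mul, mul_inv_cancel₀ ht0.ne', C_1]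
      have e2 : (C s ^ 2 : MvPolynomial ι ℝ) = 1 := by rw [← C_pow, hs, C_1]
      -- Completing the square yields `l (X_i - a_i)² + s (X_i - a_i) p + p²/(4l)`. Adding
      -- `3p²/(4l)` and `(b² - p²)/l` turns the `p²` term into the constant `b²/l`.
      have h6 := hM.sq_mem (C t * (X i - C (a i)) + C (s / 2) * C t⁻¹ * p)
      have h7 := hM.const_mul_mem (inv_nonneg.2 hl.le) hb3
      have h8 := hM.const_mul_mem (c := (3 / 4) * l⁻¹) (by positivity) (hM.sq_mem p)
      have h9 := hM.const_mul_mem hl.le hSi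
      have e3 : (C s : MvPolynomial ι ℝ) = 2 * C (s / 2) := by
        rw [← map_ofNat C 2, ← C_mul]; congr 1; ring
      have e4 : (4 * C (3 / 4) : MvPolynomial ι ℝ) = 3 := by
        rw [← map_ofNat C 4, ← C_mul, ← map_ofNat C 3]; norm_num
      have e5 : (4 * C (s / 2) ^ 2 : MvPolynomial ι ℝ) = 1 := by
        rw [← e2, e3]; ring
      have e6 : (C (s / 2) ^ 2 + C (3 / 4) : MvPolynomial ι ℝ) = 1 := by
        rw [← C_pow, ← C_add, div_pow, hs, ← C_1]; norm_num
      have e7 : (C t⁻¹ ^ 2 : MvPolynomial ι ℝ) = C l⁻¹ := by rw [← C_pow, inv_pow, ht]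
      have e8 : (C t ^ 2 : MvPolynomial ι ℝ) = C l := by rw [← C_pow, ht]
      rw [algebraMap_eq] at h7 h8 h9
      convert add_mem (add_mem (add_mem h6 h7) h8) h9 using 1
      rw [e3]
      simp only [C_mul, C_pow]
      linear_combination (-2 * C (s / 2) * (X i - C (a i)) * p) * e1 - C l⁻¹ * p ^ 2 * e6
        - C (s / 2) ^ 2 * p ^ 2 * e7 - (X i - C (a i)) ^ 2 * e8
    -- the contribution of `a i * (p - p(a))`
    have h6 : ∀ s : ℝ, s ^ 2 = 1 → C (A * c * l⁻¹) + C (A * c * l) * S +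
        C s * (C (a i) * (p - C (eval a p))) ∈ boxModule lo hi := by
      intro s hs
      have h7 : |s| = 1 := by
        rcases mul_self_eq_one_iff.1 ((sq s).symm.trans hs) with rfl | rfl <;> simp
      have h8 : |s * a i| ≤ A := by rwa [abs_mul, h7, one_mul]
      obtain ⟨h9, h10⟩ := abs_le.1 h8
      -- The two nonnegative weights have sum `A` and difference `s * a i`.
      have h11 := hM.const_mul_mem (c := (A + s * a i) / 2) (by linarith) h3
      have h12 := hM.const_mul_mem (c := (A - s * a i) / 2) (by linarith) h4
      convert add_mem h11 h12 using 1
      have e1 : (C ((A + s * a i) / 2) + C ((A - s * a i) / 2) : MvPolynomial ι ℝ) = C A := by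
        rw [← C_add]; congr 1; ring
      have e2 : (C ((A + s * a i) / 2) - C ((A - s * a i) / 2) : MvPolynomial ι ℝ) =
          C s * C (a i) := by
        rw [← C_sub, ← C_mul]; congr 1; ring
      simp only [C_mul, algebraMap_eq]
      linear_combination -(C c * C l⁻¹ + C c * C l * S) * e1 - (p - C (eval a p)) * e2
    have h7 : C l⁻¹ + C (b ^ 2 * l) * S ∈ boxModule lo hi :=
      add_mem (hM.const_mem (inv_nonneg.2 hl.le)) (hM.const_mul_mem (by positivity) hS0)
    constructor
    · convert add_mem (add_mem (h5 1 (by norm_num)) (h6 1 (by norm_num))) h7 using 1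
      simp only [eval_mul, eval_X, C_mul, C_add, C_pow, C_1]
      ring
    · convert add_mem (add_mem (h5 (-1) (by norm_num)) (h6 (-1) (by norm_num))) h7 using 1
      simp only [eval_mul, eval_X, C_mul, C_add, C_pow, C_1, C_neg]
      ring

end Box

/-! ### Bernstein partitions of unity and Putinar's theorem for a box -/

section Bernstein

open MvPolynomial

variable {ι : Type*} [Fintype ι]

/-- A preordering contains the values of Bernstein polynomials at its elements between `0`
and `1`. -/
theorem aeval_bernsteinPolynomial_mem {R : Type*} [CommRing R] [Algebra ℝ R] {T : Subsemiring R}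
    {y : R} (h0 : y ∈ T) (h1 : 1 - y ∈ T) (n ν : ℕ) :
    Polynomial.aeval y (bernsteinPolynomial ℝ n ν) ∈ T := by
  simp only [bernsteinPolynomial, map_mul, map_natCast, map_pow, Polynomial.aeval_X, map_sub,
    map_one]
  exact T.mul_mem (T.mul_mem (natCast_mem T _) (T.pow_mem h0 _)) (T.pow_mem h1 _)

variable {lo hi : ι → ℝ}

/-- A partition of unity, in the preordering of the box, concentrated near points of the box. -/
theorem exists_partition (h : ∀ j, lo j < hi j) {δ : ℝ} (hδ : 0 < δ) :
    ∃ (s : Finset (ι → ℕ)) (w : (ι → ℕ) → MvPolynomial ι ℝ) (a : (ι → ℕ) → ι → ℝ),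
      (∀ α ∈ s, a α ∈ Set.Icc lo hi) ∧
      (∀ α ∈ s, w α ∈ (isQuadModule_boxModule lo hi).preordering (isArchModule_boxModule h)) ∧
      ∑ α ∈ s, w α = 1 ∧
      ∀ i, C δ - ∑ α ∈ s, w α * (X i - C (a α i)) ^ 2 ∈
        (isQuadModule_boxModule lo hi).preordering (isArchModule_boxModule h) := by
  classical
  have hM := isQuadModule_boxModule lo hi
  set T := hM.preordering (isArchModule_boxModule h)
  have hL : ∀ j, 0 < hi j - lo j := fun j => sub_pos.2 (h j)
  set y : ι → MvPolynomial ι ℝ := fun j => C (hi j - lo j)⁻¹ * (X j - C (lo j)) with hy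
  have e : ∀ j, (C (hi j - lo j)⁻¹ * (C (hi j) - C (lo j)) : MvPolynomial ι ℝ) = 1 := fun j => by
    rw [← C_sub, ← C_mul, inv_mul_cancel₀ (hL j).ne', C_1]
  have hy0 : ∀ j, y j ∈ T := fun j => hM.le_preordering _
    (hM.const_mul_mem (inv_nonneg.2 (hL j).le) (X_sub_mem_boxModule h j))
  have hy1 : ∀ j, 1 - y j ∈ T := fun j => by
    have := hM.le_preordering (isArchModule_boxModule h)
      (hM.const_mul_mem (inv_nonneg.2 (hL j).le) (sub_X_mem_boxModule h j))
    rw [algebraMap_eq] at this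
    convert this using 1
    linear_combination -e j
  -- The Bernstein variance in direction `i` is `(hi i - lo i)² y(1 - y)/n`; this `n` brings the
  -- coefficient below `δ`.
  obtain ⟨n, hn⟩ := exists_nat_gt ((∑ j, (hi j - lo j) ^ 2) / δ)
  have hn0 : (0 : ℝ) < n := lt_of_le_of_lt (by positivity) hn
  set b : ι → ℕ → MvPolynomial ι ℝ := fun j ν =>
    Polynomial.aeval (y j) (bernsteinPolynomial ℝ n ν) with hb
  have hbs : ∀ j, ∑ ν ∈ Finset.range (n + 1), b j ν = 1 := fun j => by
    simp only [hb, ← map_sum, bernsteinPolynomial.sum, map_one]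
  have hbv : ∀ j, ∑ ν ∈ Finset.range (n + 1), (n * y j - ν) ^ 2 * b j ν =
      n * y j * (1 - y j) := fun j => by
    have := congrArg (Polynomial.aeval (y j)) (bernsteinPolynomial.variance ℝ n)
    simpa [nsmul_eq_mul] using this
  refine ⟨Fintype.piFinset fun _ => Finset.range (n + 1), fun α => ∏ j, b j (α j),
    fun α j => lo j + (hi j - lo j) * (α j / n), fun α hα => ?_, fun α _ => ?_, ?_, fun i => ?_⟩
  · rw [Fintype.mem_piFinset] at hα
    have h1 : ∀ j, ((α j : ℝ) / n) ≤ 1 := fun j => by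
      rw [div_le_one hn0]
      exact_mod_cast Nat.lt_succ_iff.1 (Finset.mem_range.1 (hα j))
    have h0 : ∀ j, 0 ≤ ((α j : ℝ) / n) := fun j => by positivity
    exact ⟨fun j => by nlinarith [h0 j, hL j], fun j => by nlinarith [h1 j, hL j]⟩
  · exact T.prod_mem fun j _ => aeval_bernsteinPolynomial_mem (hy0 j) (hy1 j) n (α j)
  · rw [← Finset.prod_univ_sum]
    simp [hbs]
  -- Absorb the square into the `i`-th factor, so that the sum over the grid factorizes; the other
  -- factors sum to one.
  · have h1 : ∀ α : ι → ℕ, (∏ j, b j (α j)) *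
        (X i - C (lo i + (hi i - lo i) * (α i / n))) ^ 2 =
        ∏ j, b j (α j) * (if j = i then C (((hi i - lo i) / n) ^ 2) * ((n : MvPolynomial ι ℝ) * y i - (α j : MvPolynomial ι ℝ)) ^ 2
          else 1) := fun α => by
      rw [Finset.prod_mul_distrib]
      congr 1
      rw [Finset.prod_eq_single i (fun j _ hj => by simp [hj]) (by simp), if_pos rfl,
        C_pow, ← mul_pow]
      congr 1
      have e1 : (C ((hi i - lo i) / n) * (n : MvPolynomial ι ℝ) * C (hi i - lo i)⁻¹ : MvPolynomial ι ℝ) = 1 := by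
        rw [← map_natCast C, ← C_mul, ← C_mul, ← C_1]
        congr 1
        have := (hL i).ne'
        field_simp
      have e2 : (C (lo i + (hi i - lo i) * (α i / n)) : MvPolynomial ι ℝ) =
          C (lo i) + C ((hi i - lo i) / n) * (α i : MvPolynomial ι ℝ) := by
        rw [← map_natCast C, ← C_mul, ← C_add]
        congr 1
        ring
      rw [e2]
      simp only [hy]
      linear_combination -(X i - C (lo i)) * e1
    simp only [h1]
    rw [← Finset.prod_univ_sum (fun _ => Finset.range (n + 1)) fun j ν =>
      b j ν * (if j = i then C (((hi i - lo i) / n) ^ 2) *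
        ((n : MvPolynomial ι ℝ) * y i - (ν : MvPolynomial ι ℝ)) ^ 2 else 1),
      Finset.prod_eq_single i (fun j _ hj => by simp [hj, hbs]) (by simp)]
    have h2 : ∑ ν ∈ Finset.range (n + 1), b i ν *
        (if i = i then C (((hi i - lo i) / n) ^ 2) *
          ((n : MvPolynomial ι ℝ) * y i - (ν : MvPolynomial ι ℝ)) ^ 2 else 1) =
        C ((hi i - lo i) ^ 2 / n) * (y i * (1 - y i)) := by
      have e1 : (C ((hi i - lo i) ^ 2 / n) : MvPolynomial ι ℝ) =
          C (((hi i - lo i) / n) ^ 2) * (n : MvPolynomial ι ℝ) := by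
        rw [← map_natCast C, ← C_mul]
        congr 1
        field_simp
      rw [e1, mul_assoc, ← mul_assoc (n : MvPolynomial ι ℝ) (y i) (1 - y i), ← hbv, Finset.mul_sum]
      refine Finset.sum_congr rfl fun ν _ => ?_
      rw [if_pos rfl]
      ring
    rw [h2]
    have h3 : (hi i - lo i) ^ 2 / n ≤ δ := by
      rw [div_le_iff₀ hn0]
      rw [div_lt_iff₀ hδ] at hn
      have := Finset.single_le_sum (f := fun j => (hi j - lo j) ^ 2)
        (fun _ _ => sq_nonneg _) (Finset.mem_univ i)
      linarith
    have h4 : ∀ c : ℝ, 0 ≤ c → C c ∈ T := fun c hc => hM.le_preordering _ (hM.const_mem hc)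
    -- `1 - y(1 - y) = (1 - y) + y²`, a sum of elements of `T`.
    have h5 := T.mul_mem (h4 ((hi i - lo i) ^ 2 / n) (by positivity))
      (T.add_mem (hy1 i) (T.pow_mem (hy0 i) 2))
    convert T.add_mem h5 (h4 _ (sub_nonneg.2 h3)) using 1
    rw [C_sub]
    ring

/-- A polynomial that is nonnegative on the box lies in the closure of the quadratic module. -/
theorem mem_preordering_of_nonneg (h : ∀ j, lo j < hi j) {f : MvPolynomial ι ℝ}
    (hf : ∀ x ∈ Set.Icc lo hi, 0 ≤ eval x f) :
    f ∈ (isQuadModule_boxModule lo hi).preordering (isArchModule_boxModule h) := by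
  have hM := isQuadModule_boxModule lo hi
  set T := hM.preordering (isArchModule_boxModule h)
  have hC : ∀ c : ℝ, 0 ≤ c → C c ∈ T := fun c hc => hM.le_preordering _ (hM.const_mem hc)
  intro ε hε
  obtain ⟨c, hc, hcf⟩ := exists_sub_eval_mem h f
  -- Error budget: `ε/4` for `c/l`, then `ε/4` for the second moments through `δ`, and `ε/2` for
  -- passing from the closure back to the module.
  set l : ℝ := (c + 1) * 4 / ε with hl
  have hl0 : 0 < l := by positivity
  have hl1 : c * l⁻¹ ≤ ε / 4 := by
    rw [hl, inv_div, mul_div_assoc', div_le_div_iff₀ (by positivity) (by positivity)]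
    nlinarith
  set δ : ℝ := ε / (4 * (c * l * Fintype.card ι + 1)) with hδ
  have hδ1 : c * l * (Fintype.card ι * δ) ≤ ε / 4 := by
    have e : δ * (4 * (c * l * Fintype.card ι + 1)) = ε := div_mul_cancel₀ _ (by positivity)
    have hδ0 : 0 < δ := by positivity
    linarith
  obtain ⟨s, w, a, ha, hw, hw1, hwv⟩ := exists_partition h (δ := δ) (by positivity)
  -- The values `f(a α)` cancel, leaving `f + c/l` plus `c l` times the second moments, which `h2`
  -- trades for a constant.
  have h1 : ∑ α ∈ s, w α * (C (c * l⁻¹) + C (c * l) * ∑ i, (X i - C (a α i)) ^ 2 +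
      (f - C (eval (a α) f)) + C (eval (a α) f)) ∈ T := by
    refine T.sum_mem fun α hα => T.mul_mem (hw α hα) (T.add_mem ?_ (hC _ (hf _ (ha α hα))))
    exact hM.le_preordering _ (hcf l hl0 _ (ha α hα)).1
  have h2 : C (c * l) * ∑ i, (C δ - ∑ α ∈ s, w α * (X i - C (a α i)) ^ 2) ∈ T :=
    T.mul_mem (hC _ (by positivity)) (T.sum_mem fun i _ => hwv i)
  have h3 : f + C (c * l⁻¹ + c * l * (Fintype.card ι * δ)) ∈ T := by
    convert T.add_mem h1 h2 using 1
    have e1 : ∑ α ∈ s, w α * (C (c * l⁻¹) + C (c * l) * ∑ i, (X i - C (a α i)) ^ 2 +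
        (f - C (eval (a α) f)) + C (eval (a α) f)) =
        (∑ α ∈ s, w α) * (C (c * l⁻¹) + f) +
          C (c * l) * ∑ i, ∑ α ∈ s, w α * (X i - C (a α i)) ^ 2 := by
      rw [Finset.sum_comm, Finset.sum_mul, Finset.mul_sum, ← Finset.sum_add_distrib]
      refine Finset.sum_congr rfl fun α _ => ?_
      rw [← Finset.mul_sum]
      ring
    rw [e1, hw1, Finset.sum_sub_distrib, Finset.sum_const, Finset.card_univ, nsmul_eq_mul,
      C_add, C_mul (a := c * l), C_mul (a := (Fintype.card ι : ℝ)), map_natCast]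
    ring
  have h4 := h3 (ε / 2) (by positivity)
  rw [add_assoc, algebraMap_eq, ← C_add] at h4
  exact hM.add_const_mem (c := c * l⁻¹ + c * l * (Fintype.card ι * δ) + ε / 2) h4 (by linarith)

/-- Putinar's Positivstellensatz for a box. -/
theorem mem_boxModule_of_pos (h : ∀ j, lo j < hi j) {f : MvPolynomial ι ℝ}
    (hf : ∀ x ∈ Set.Icc lo hi, 0 < eval x f) : f ∈ boxModule lo hi := by
  have hne : (Set.Icc lo hi).Nonempty := Set.nonempty_Icc.2 fun j => (h j).le
  obtain ⟨x, hx, hmin⟩ := isCompact_Icc.exists_isMinOn hne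
    (MvPolynomial.continuous_eval f).continuousOn
  -- The positive minimum serves as the slack in the definition of the closure.
  have := mem_preordering_of_nonneg h (f := f - C (eval x f))
    (fun z hz => by simpa using hmin hz) (eval x f) (hf x hx)
  simpa [algebraMap_eq] using this

end Bernstein

/-! ### Gram matrices of sums of squares -/

section Gram

open MvPolynomial

variable {ι : Type*}

theorem homogeneousComponent_mul_of_le {p q : MvPolynomial ι ℝ} {m n : ℕ}
    (hp : p.totalDegree ≤ m) (hq : q.totalDegree ≤ n) :
    homogeneousComponent (m + n) (p * q) =
      homogeneousComponent m p * homogeneousComponent n q := by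
  classical
  ext d
  simp only [coeff_homogeneousComponent, coeff_mul]
  have h0 : ∀ {r : MvPolynomial ι ℝ} {l : ℕ} {e : ι →₀ ℕ}, r.totalDegree ≤ l → l < e.degree →
      coeff e r = 0 := fun hr he => coeff_eq_zero_of_totalDegree_lt (hr.trans_lt he)
  split_ifs with hd
  · refine Finset.sum_congr rfl fun x hx => ?_
    have hx' : x.1.degree + x.2.degree = m + n := by
      rw [← map_add, Finset.HasAntidiagonal.mem_antidiagonal.1 hx, hd]
    rcases lt_trichotomy x.1.degree m with h | h | h
    · rw [h0 hq (e := x.2) (by omega), if_neg (by omega), mul_zero, zero_mul]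
    · rw [if_pos h, if_pos (by omega)]
    · rw [h0 hp h, if_neg (by omega), zero_mul, zero_mul]
  · refine (Finset.sum_eq_zero fun x hx => ?_).symm
    have hx' : x.1.degree + x.2.degree = d.degree := by
      rw [← map_add, Finset.HasAntidiagonal.mem_antidiagonal.1 hx]
    by_cases h : x.1.degree = m
    · rw [if_neg (c := x.2.degree = n) (by omega), mul_zero]
    · rw [if_neg h, zero_mul]

theorem totalDegree_le_of_homogeneousComponent_eq_zero {p : MvPolynomial ι ℝ} {m : ℕ}
    (hp : p.totalDegree ≤ m + 1) (h : homogeneousComponent (m + 1) p = 0) :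
    p.totalDegree ≤ m := by
  refine Finset.sup_le fun s hs => ?_
  have h1 : s.degree ≤ m + 1 := (le_totalDegree hs).trans hp
  have h2 : s.degree ≠ m + 1 := fun e => by
    have := congrArg (coeff s) h
    rw [coeff_homogeneousComponent, if_pos e, coeff_zero] at this
    exact (mem_support_iff.1 hs) this
  change s.degree ≤ m
  omega

/-- The leading forms in a sum of squares do not cancel. -/
theorem totalDegree_le_of_sum_sq {κ : Type*} [Fintype κ] (q : κ → MvPolynomial ι ℝ) {d : ℕ}
    (hd : (∑ i, q i ^ 2).totalDegree ≤ d) (i : κ) : (q i).totalDegree ≤ d / 2 := by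
  -- Descend from any common degree bound, removing one top homogeneous layer at a time.
  suffices ∀ D, (∀ i, (q i).totalDegree ≤ d / 2 + D) → ∀ i, (q i).totalDegree ≤ d / 2 from
    this (Finset.univ.sup fun i => (q i).totalDegree)
      (fun i => le_add_left (Finset.le_sup (f := fun i => (q i).totalDegree) (Finset.mem_univ i))) i
  intro D
  induction D with
  | zero => exact id
  | succ D ih =>
    intro h
    refine ih fun i => totalDegree_le_of_homogeneousComponent_eq_zero (h i) ?_
    set m := d / 2 + D + 1 with hm
    -- As `m ≥ d / 2 + 1`, one has `2m > d` for either parity of `d`.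
    have h1 : homogeneousComponent (m + m) (∑ i, q i ^ 2) = 0 :=
      homogeneousComponent_eq_zero _ _ (by omega)
    rw [map_sum] at h1
    have h' : ∀ i, homogeneousComponent (m + m) (q i ^ 2) =
        homogeneousComponent m (q i) * homogeneousComponent m (q i) := fun i => by
      rw [sq]
      exact homogeneousComponent_mul_of_le (h i) (h i)
    simp only [h'] at h1
    refine MvPolynomial.funext fun x => ?_
    have h2 := congrArg (eval x) h1
    simp only [map_sum, map_mul, map_zero] at h2 ⊢
    exact mul_self_eq_zero.1
      ((Finset.sum_eq_zero_iff_of_nonneg fun j _ => mul_self_nonneg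
        (eval x (homogeneousComponent m (q j)))).1 h2 i (Finset.mem_univ i))

theorem exists_sum_sq_of_isSumSq {R : Type*} [CommSemiring R] {s : R} (h : IsSumSq s) :
    ∃ (n : ℕ) (q : Fin n → R), s = ∑ i, q i ^ 2 := by
  induction h with
  | zero => exact ⟨0, 0, by simp⟩
  | sq_add a _ ih =>
    obtain ⟨n, q, rfl⟩ := ih
    exact ⟨n + 1, Fin.cons a q, by simp [Fin.sum_univ_succ, sq]⟩

variable {I : Type*} [Fintype I]

/-- The sum of the squares of the polynomials with coordinates the rows of `A`. -/
noncomputable def gram (b : I → MvPolynomial ι ℝ) (A : I → I → ℝ) : MvPolynomial ι ℝ :=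
  ∑ i, (∑ j, A i j • b j) ^ 2

theorem sum_sq_eq_conjTranspose_mul {κ : Type*} [Fintype κ] (b : I → MvPolynomial ι ℝ)
    (V : Matrix κ I ℝ) : ∑ l, (∑ j, V l j • b j) ^ 2 =
      ∑ j, ∑ j', (V.conjTranspose * V) j j' • (b j * b j') := by
  simp only [sq, Finset.sum_mul_sum, Matrix.mul_apply, Matrix.conjTranspose_apply, star_trivial,
    Finset.sum_smul, smul_mul_smul_comm]
  rw [Finset.sum_comm]
  exact Finset.sum_congr rfl fun j _ => Finset.sum_comm

open scoped MatrixOrder in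
/-- The number of squares can be reduced to the dimension. -/
theorem exists_gram_eq_sum_sq {κ : Type*} [Fintype κ] (b : I → MvPolynomial ι ℝ)
    (V : κ → I → ℝ) : ∃ A, ∑ l, (∑ j, V l j • b j) ^ 2 = gram b A := by
  classical
  -- The sum depends only on the positive semidefinite matrix `Vᴴ V`, which has a square factor.
  obtain ⟨A, hA⟩ := (CStarAlgebra.nonneg_iff_eq_star_mul_self).1
    (Matrix.posSemidef_conjTranspose_mul_self (Matrix.of V)).nonneg
  refine ⟨A, ?_⟩
  refine (sum_sq_eq_conjTranspose_mul b (Matrix.of V)).trans ?_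
  rw [hA, Matrix.star_eq_conjTranspose]
  exact (sum_sq_eq_conjTranspose_mul b A).symm

theorem exists_basis_totalDegree_le (k m : ℕ) :
    ∃ (N : ℕ) (b : Fin N → MvPolynomial (Fin k) ℝ), LinearIndependent ℝ b ∧
      (∀ j, (b j).totalDegree ≤ m) ∧
      ∀ q : MvPolynomial (Fin k) ℝ, q.totalDegree ≤ m → ∃ v : Fin N → ℝ, q = ∑ j, v j • b j := by
  let b := Module.finBasis ℝ (restrictTotalDegree (Fin k) ℝ m)
  refine ⟨_, fun j => (b j : MvPolynomial (Fin k) ℝ), ?_, fun j => ?_, fun q hq => ?_⟩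
  · exact b.linearIndependent.map' (Submodule.subtype _) (Submodule.ker_subtype _)
  · exact (mem_restrictTotalDegree _ _ _).1 (b j).2
  · refine ⟨b.repr ⟨q, (mem_restrictTotalDegree _ _ _).2 hq⟩, ?_⟩
    have := congrArg Subtype.val (b.sum_repr ⟨q, (mem_restrictTotalDegree _ _ _).2 hq⟩)
    rw [AddSubmonoidClass.coe_finsetSum] at this
    exact this.symm

/-- Sums of squares of bounded degree are parametrized by square matrices. -/
theorem exists_gram_param (k d : ℕ) :
    ∃ (N : ℕ) (b : Fin N → MvPolynomial (Fin k) ℝ), LinearIndependent ℝ b ∧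
      ∀ s, s ∈ SOS k d ↔ ∃ A, s = gram b A := by
  obtain ⟨N, b, hb, hbd, hbs⟩ := exists_basis_totalDegree_le k (d / 2)
  refine ⟨N, b, hb, fun s => ⟨?_, ?_⟩⟩
  · rintro ⟨hs, hd⟩
    obtain ⟨n, q, rfl⟩ := exists_sum_sq_of_isSumSq hs
    choose V hV using fun i => hbs (q i) (totalDegree_le_of_sum_sq q hd i)
    simp only [hV]
    exact exists_gram_eq_sum_sq b V
  · rintro ⟨A, rfl⟩
    refine ⟨.sum_sq _ _, totalDegree_finsetSum_le fun i _ => ?_⟩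
    refine (totalDegree_pow _ _).trans ?_
    have : (∑ j, A i j • b j).totalDegree ≤ d / 2 :=
      totalDegree_finsetSum_le fun j _ => (totalDegree_smul_le _ _).trans (hbd j)
    omega

theorem continuous_eval_gram (b : I → MvPolynomial ι ℝ) (x : ι → ℝ) :
    Continuous fun A => eval x (gram b A) := by
  simp only [gram, map_sum, map_pow, smul_eval]
  fun_prop

theorem eval_gram_nonneg (b : I → MvPolynomial ι ℝ) (A : I → I → ℝ) (x : ι → ℝ) :
    0 ≤ eval x (gram b A) := by
  simp only [gram, map_sum, map_pow]
  positivity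

theorem sq_eval_le_gram (b : I → MvPolynomial ι ℝ) (A : I → I → ℝ) (x : ι → ℝ) (i : I) :
    eval x (∑ j, A i j • b j) ^ 2 ≤ eval x (gram b A) := by
  have e : eval x (gram b A) = ∑ i, eval x (∑ j, A i j • b j) ^ 2 := by
    rw [gram, map_sum]
    simp only [map_pow]
  rw [e]
  exact Finset.single_le_sum (f := fun i => eval x (∑ j, A i j • b j) ^ 2)
    (fun _ _ => sq_nonneg _) (Finset.mem_univ i)

/-- Restriction of polynomial functions to a box. -/
noncomputable def evalBox (lo hi : ι → ℝ) :
    MvPolynomial ι ℝ →ₗ[ℝ] C(Set.Icc lo hi, ℝ) where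
  toFun p := ⟨fun x => eval x.1 p, (MvPolynomial.continuous_eval p).comp continuous_subtype_val⟩
  map_add' p q := by ext; simp
  map_smul' c p := by ext; simp [smul_eval]

theorem eq_zero_of_eval_box [Finite ι] {lo hi : ι → ℝ} (h : ∀ j, lo j < hi j)
    {p : MvPolynomial ι ℝ} (hp : ∀ x ∈ Set.Icc lo hi, eval x p = 0) : p = 0 := by
  refine funext_set (fun j => Set.Icc (lo j) (hi j)) (fun j => Set.Icc_infinite (h j)) ?_
  intro x hx
  rw [Set.pi_univ_Icc] at hx
  rw [hp x hx, map_zero]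

/-- On a full-dimensional box, coefficients are controlled by values. -/
theorem exists_norm_le_of_eval_le [Finite ι] {lo hi : ι → ℝ} (h : ∀ j, lo j < hi j)
    {b : I → MvPolynomial ι ℝ} (hb : LinearIndependent ℝ b) :
    ∃ r : ℝ, 0 ≤ r ∧ ∀ (v : I → ℝ) (c : ℝ), 0 ≤ c →
      (∀ x ∈ Set.Icc lo hi, |eval x (∑ j, v j • b j)| ≤ c) → ‖v‖ ≤ r * c := by
  -- An injective linear map on a finite-dimensional space is bounded below.
  obtain ⟨K, -, hK⟩ := LinearMap.exists_antilipschitzWith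
    (evalBox lo hi ∘ₗ Fintype.linearCombination ℝ b) (by
      rw [LinearMap.ker_eq_bot']
      intro v hv
      have h1 : ∑ j, v j • b j = 0 := eq_zero_of_eval_box h fun x hx => by
        have := congrArg (fun f : C(Set.Icc lo hi, ℝ) => f ⟨x, hx⟩) hv
        simpa [evalBox, Fintype.linearCombination_apply] using this
      exact funext (Fintype.linearIndependent_iff.1 hb v h1))
  refine ⟨K, K.2, fun v c hc hv => ?_⟩
  have h1 := hK.le_mul_dist v 0
  rw [map_zero, dist_zero_right, dist_zero_right] at h1
  refine h1.trans (mul_le_mul_of_nonneg_left ?_ K.2)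
  refine (ContinuousMap.norm_le _ hc).2 fun x => ?_
  simpa [evalBox, Fintype.linearCombination_apply] using hv x.1 x.2

/-- Gram matrices are bounded by the values of the sum of squares, even after multiplication
by a nonzero polynomial `g` that is nonnegative on the box. -/
theorem exists_norm_gram_le [Finite ι] {lo hi : ι → ℝ} (h : ∀ j, lo j < hi j)
    {b : I → MvPolynomial ι ℝ} (hb : LinearIndependent ℝ b) {g : MvPolynomial ι ℝ} (hg : g ≠ 0)
    (hg0 : ∀ x ∈ Set.Icc lo hi, 0 ≤ eval x g) (c : ℝ) :
    ∃ r : ℝ, ∀ A : I → I → ℝ,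
      (∀ x ∈ Set.Icc lo hi, eval x (gram b A) * eval x g ≤ c) → ‖A‖ ≤ r := by
  have hb' : LinearIndependent ℝ fun j => g * b j := by
    refine hb.map' (LinearMap.mulLeft ℝ g) (LinearMap.ker_eq_bot.2 ?_)
    exact mul_right_injective₀ hg
  obtain ⟨G, hG⟩ := (isCompact_Icc (a := lo) (b := hi)).bddAbove_image
    (MvPolynomial.continuous_eval g).continuousOn
  obtain ⟨r, hr, hrb⟩ := exists_norm_le_of_eval_le h hb'
  -- For the polynomial `q` of a row of `A`, `(g q)² = g · (g q²) ≤ G c` on the box.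
  refine ⟨r * Real.sqrt (G * c), fun A hA => ?_⟩
  refine (pi_norm_le_iff_of_nonneg (by positivity)).2 fun i => ?_
  refine hrb _ _ (Real.sqrt_nonneg _) fun x hx => Real.abs_le_sqrt ?_
  have h1 : ∑ j, A i j • (g * b j) = g * ∑ j, A i j • b j := by
    simp only [Finset.mul_sum, mul_smul_comm]
  have h2 : eval x g ≤ G := hG ⟨x, hx, rfl⟩
  have h3 := hg0 x hx
  rw [h1, map_mul, mul_pow, sq (eval x g), mul_assoc]
  refine mul_le_mul h2 (le_trans ?_ (hA x hx)) (by positivity) (h3.trans h2)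
  rw [mul_comm]
  exact mul_le_mul_of_nonneg_right (sq_eval_le_gram b A x i) h3

end Gram

/-! ### The separation problem and its sums of squares restriction -/

section Problem

/-- Otherwise the monomial is constant on a full-dimensional box, hence constant as a polynomial.
This makes `tildeK` full-dimensional. -/
theorem monoMin_lt_monoMax {n : ℕ} {a b : Fin n → ℝ} (hab : ∀ i, a i < b i) {α : Fin n → ℕ}
    (hα : α ≠ 0) : monoMin a b α < monoMax a b α := by
  have h1 := isLeast_monoMin hab α
  have h2 := isGreatest_monoMax hab α
  refine lt_of_le_of_ne (h1.2 h2.1) fun h => hα ?_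
  have h3 : MvPolynomial.monomial (Finsupp.equivFunOnFinite.symm α) (1 : ℝ) -
      MvPolynomial.C (monoMin a b α) = 0 := eq_zero_of_eval_box hab fun x hx => by
    have h4 : mono α x = monoMin a b α :=
      le_antisymm (h ▸ h2.2 ⟨x, hx, rfl⟩) (h1.2 ⟨x, hx, rfl⟩)
    rw [← h4, mono]
    simp [MvPolynomial.eval_monomial, Finsupp.prod_fintype]
  by_contra hne
  have h5 := congrArg (MvPolynomial.coeff (Finsupp.equivFunOnFinite.symm α)) h3
  have h6 : (0 : Fin n →₀ ℕ) ≠ Finsupp.equivFunOnFinite.symm α := fun e => hne <| by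
    rw [← Equiv.apply_symm_apply Finsupp.equivFunOnFinite α, ← e]
    rfl
  rw [MvPolynomial.coeff_sub, MvPolynomial.coeff_monomial, if_pos rfl, MvPolynomial.coeff_C,
    if_neg h6] at h5
  simp at h5

variable {n k : ℕ} {a b : Fin n → ℝ} {B : Finset (Fin n → ℕ)} {Γ : Matrix (Fin n) (Fin k) ℕ}
  {v : TS Γ B → ℝ}

theorem continuous_eval_pPoly (h0 : ∀ j, Γ.col j ≠ 0) :
    Continuous fun z : (TS Γ B → ℝ) × (Fin k → ℝ) => MvPolynomial.eval z.2 (pPoly z.1) := by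
  have := (tildeP_finite B h0).fintype
  simp only [pPoly, finsum_eq_sum_of_fintype, map_sum, MvPolynomial.eval_monomial,
    Finsupp.prod_fintype _ _ (fun _ => pow_zero _)]
  fun_prop

theorem pPoly_zero : pPoly (0 : TS Γ B → ℝ) = 0 := by
  simp [pPoly]

theorem continuous_objective (v : TS Γ B → ℝ) : Continuous (objective v) := by
  unfold objective
  fun_prop

theorem objective_zero : objective v (0 : Cut Γ B) = 0 := by
  simp [objective]

theorem zero_mem_feasTrunc : (0 : Cut Γ B) ∈ feasTrunc a b Γ B :=
  ⟨fun x _ => by simp [pPoly_zero], fun β => by simp⟩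

theorem zero_mem_feasSOS (d : ℕ) : (0 : CutSOS Γ B) ∈ feasSOS a b Γ B d :=
  ⟨⟨.zero, by simp⟩, fun j => ⟨.zero, by simp⟩, by simp [pPoly_zero], fun β => by simp⟩

theorem isClosed_feasTrunc (h0 : ∀ j, Γ.col j ≠ 0) : IsClosed (feasTrunc a b Γ B) := by
  have h1 : feasTrunc a b Γ B =
      (⋂ x ∈ tildeK a b Γ, {z : Cut Γ B | z.2 ≤ MvPolynomial.eval x (pPoly z.1)}) ∩
        ⋂ β, {z : Cut Γ B | z.1 β ∈ Set.Icc (-1 : ℝ) 1} := by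
    ext z
    simp [feasTrunc]
  rw [h1]
  refine (isClosed_biInter fun x _ => isClosed_le continuous_snd ?_).inter
    (isClosed_iInter fun β => isClosed_Icc.preimage (by fun_prop))
  exact (continuous_eval_pPoly h0).comp (continuous_fst.prodMk continuous_const)

/-- Feasible pairs at least as good as the trivial one. -/
def goodTrunc (a b : Fin n → ℝ) (v : TS Γ B → ℝ) : Set (Cut Γ B) :=
  feasTrunc a b Γ B ∩ {z | 0 ≤ objective v z}

/-- The coefficients lie in a cube. Feasibility at one point of `tildeK` bounds `δ` above; the
nonnegative objective bounds it below, which feasibility alone does not. -/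
theorem isCompact_goodTrunc (hab : ∀ i, a i < b i) (h0 : ∀ j, Γ.col j ≠ 0) :
    IsCompact (goodTrunc a b v) := by
  have hcube : IsCompact (Set.Icc (fun _ => -1) (fun _ => 1) : Set (TS Γ B → ℝ)) := isCompact_Icc
  set x0 : Fin k → ℝ := fun j => monoMin a b (Γ.col j)
  have hx0 : x0 ∈ tildeK a b Γ :=
    ⟨le_rfl, fun j => (monoMin_lt_monoMax hab (h0 j)).le⟩
  obtain ⟨U, hU⟩ := hcube.bddAbove_image
    ((continuous_eval_pPoly (B := B) h0).comp (continuous_id.prodMk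
      (continuous_const (y := x0)))).continuousOn
  obtain ⟨V, hV⟩ := hcube.bddBelow_image
    (f := fun c : TS Γ B → ℝ => ∑ β, c β * v β) (by fun_prop)
  refine (hcube.prod (isCompact_Icc (a := V) (b := U))).of_isClosed_subset
    ((isClosed_feasTrunc h0).inter (isClosed_le continuous_const (continuous_objective v))) ?_
  rintro z ⟨⟨hz1, hz2⟩, hz3⟩
  have hz : z.1 ∈ (Set.Icc (fun _ => -1) (fun _ => 1) : Set (TS Γ B → ℝ)) :=
    ⟨fun β => (hz2 β).1, fun β => (hz2 β).2⟩
  have h3 : 0 ≤ z.2 - ∑ β, z.1 β * v β := hz3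
  have h4 : V ≤ ∑ β, z.1 β * v β := hV ⟨z.1, hz, rfl⟩
  exact ⟨hz, by linarith, (hz1 x0 hx0).trans (hU ⟨z.1, hz, rfl⟩)⟩

/-- Restricting to a superlevel set does not change the maximizers. -/
theorem mem_optimal_of_superlevel {α : Type*} {f : α → ℝ} {S : Set α} {x x0 : α}
    (hx : x ∈ S ∩ {y | f x0 ≤ f y}) (hmax : IsMaxOn f (S ∩ {y | f x0 ≤ f y}) x) :
    x ∈ optimal f S := by
  refine ⟨hx.1, fun y hy => ?_⟩
  by_cases h : f x0 ≤ f y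
  · exact hmax ⟨hy, h⟩
  · exact (not_le.1 h).le.trans hx.2

theorem optTrunc_nonempty (hab : ∀ i, a i < b i) (h0 : ∀ j, Γ.col j ≠ 0) :
    (optTrunc a b Γ B v).Nonempty := by
  obtain ⟨z, hz, hmax⟩ := (isCompact_goodTrunc (v := v) hab h0).exists_isMaxOn
    ⟨0, zero_mem_feasTrunc, objective_zero.ge⟩ (continuous_objective v).continuousOn
  refine ⟨z, mem_optimal_of_superlevel (x0 := 0) ?_ ?_⟩ <;> rwa [objective_zero]

theorem eval_gPoly_nonneg {x : Fin k → ℝ} (hx : x ∈ tildeK a b Γ) (j : Fin k) :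
    0 ≤ MvPolynomial.eval x (gPoly a b Γ j) := by
  simp only [gPoly, map_mul, map_sub, MvPolynomial.eval_C, MvPolynomial.eval_X]
  exact mul_nonneg (sub_nonneg.2 (hx.2 j)) (sub_nonneg.2 (hx.1 j))

theorem gPoly_ne_zero (hab : ∀ i, a i < b i) (h0 : ∀ j, Γ.col j ≠ 0) (j : Fin k) :
    gPoly a b Γ j ≠ 0 := by
  intro h
  have h1 := congrArg (MvPolynomial.eval fun j =>
    (monoMin a b (Γ.col j) + monoMax a b (Γ.col j)) / 2) h
  have h2 := monoMin_lt_monoMax hab (h0 j)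
  simp only [gPoly, map_mul, map_sub, MvPolynomial.eval_C, MvPolynomial.eval_X, map_zero] at h1
  nlinarith

theorem eval_nonneg_of_isSumSq {ι : Type*} {s : MvPolynomial ι ℝ} (h : IsSumSq s) (x : ι → ℝ) :
    0 ≤ MvPolynomial.eval x s := by
  obtain ⟨n, q, rfl⟩ := exists_sum_sq_of_isSumSq h
  simp only [map_sum, map_pow]
  positivity

theorem mem_feasTrunc_of_mem_feasSOS {d : ℕ} {w : CutSOS Γ B} (hw : w ∈ feasSOS a b Γ B d) :
    w.1 ∈ feasTrunc a b Γ B := by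
  obtain ⟨h1, h2, h3, h4⟩ := hw
  refine ⟨fun x hx => ?_, h4⟩
  have h5 := congrArg (MvPolynomial.eval x) h3
  simp only [map_sub, map_add, map_sum, map_mul, MvPolynomial.eval_C] at h5
  have h6 := eval_nonneg_of_isSumSq h1.1 x
  have h7 : 0 ≤ ∑ j, MvPolynomial.eval x (w.2.2 j) * MvPolynomial.eval x (gPoly a b Γ j) :=
    Finset.sum_nonneg fun j _ =>
      mul_nonneg (eval_nonneg_of_isSumSq (h2 j).1 x) (eval_gPoly_nonneg hx j)
  linarith

/-- The maximum is taken over pairs together with Gram matrices. On `tildeK` the values of `p_c - δ`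
are bounded over good pairs and every summand of the certificate is nonnegative, so each Gram matrix
is bounded. -/
theorem optSOS_nonempty (hab : ∀ i, a i < b i) (h0 : ∀ j, Γ.col j ≠ 0) (d : ℕ) :
    (optSOS a b Γ B v d).Nonempty := by
  obtain ⟨N, p, hp, hpS⟩ := exists_gram_param k d
  obtain ⟨N', p', hp', hpS'⟩ := exists_gram_param k (d - 2)
  have hlt : ∀ j, monoMin a b (Γ.col j) < monoMax a b (Γ.col j) :=
    fun j => monoMin_lt_monoMax hab (h0 j)
  have hC := isCompact_goodTrunc (v := v) hab h0
  -- the parameter space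
  let P := Cut Γ B × (Fin N → Fin N → ℝ) × (Fin k → Fin N' → Fin N' → ℝ)
  let S : Set P := {y | y.1 ∈ goodTrunc a b v ∧ ∀ x : Fin k → ℝ,
    MvPolynomial.eval x (pPoly y.1.1) - y.1.2 = MvPolynomial.eval x (gram p y.2.1) +
      ∑ j, MvPolynomial.eval x (gram p' (y.2.2 j)) * MvPolynomial.eval x (gPoly a b Γ j)}
  let F : P → CutSOS Γ B := fun y => (y.1, gram p y.2.1, fun j => gram p' (y.2.2 j))
  have hFS : ∀ y, y ∈ S ↔ F y ∈ feasSOS a b Γ B d ∧ 0 ≤ objective v y.1 := by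
    intro y
    constructor
    · rintro ⟨h1, h2⟩
      refine ⟨⟨(hpS _).2 ⟨_, rfl⟩, fun j => (hpS' _).2 ⟨_, rfl⟩, MvPolynomial.funext fun x => ?_,
        h1.1.2⟩, h1.2⟩
      simpa using h2 x
    · rintro ⟨h1, h2⟩
      refine ⟨⟨mem_feasTrunc_of_mem_feasSOS h1, h2⟩, fun x => ?_⟩
      simpa using congrArg (MvPolynomial.eval x) h1.2.2.1
  have hSclosed : IsClosed S := by
    have h1 : S = (Prod.fst ⁻¹' goodTrunc a b v) ∩ ⋂ x : Fin k → ℝ, {y : P |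
        MvPolynomial.eval x (pPoly y.1.1) - y.1.2 = MvPolynomial.eval x (gram p y.2.1) +
        ∑ j, MvPolynomial.eval x (gram p' (y.2.2 j)) * MvPolynomial.eval x (gPoly a b Γ j)} := by
      ext y
      simp [S]
    rw [h1]
    refine (hC.isClosed.preimage continuous_fst).inter (isClosed_iInter fun x => isClosed_eq ?_ ?_)
    · exact ((continuous_eval_pPoly h0).comp (by fun_prop :
        Continuous fun y : P => (y.1.1, x))).sub (by fun_prop)
    · refine ((continuous_eval_gram p x).comp (by fun_prop)).add
        (continuous_finsetSum _ fun j _ => Continuous.mul ?_ continuous_const)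
      exact (continuous_eval_gram p' x).comp (by fun_prop : Continuous fun y : P => y.2.2 j)
  -- boundedness
  obtain ⟨c, hc⟩ := (hC.prod (isCompact_Icc : IsCompact (tildeK a b Γ))).bddAbove_image
    (f := fun y : Cut Γ B × (Fin k → ℝ) => MvPolynomial.eval y.2 (pPoly y.1.1) - y.1.2)
    (((continuous_eval_pPoly h0).comp (by fun_prop :
      Continuous fun y : Cut Γ B × (Fin k → ℝ) => (y.1.1, y.2))).sub (by fun_prop)).continuousOn
  have hle : ∀ y ∈ S, ∀ x ∈ tildeK a b Γ, MvPolynomial.eval x (gram p y.2.1) +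
      ∑ j, MvPolynomial.eval x (gram p' (y.2.2 j)) * MvPolynomial.eval x (gPoly a b Γ j) ≤ c := by
    rintro y ⟨h1, h2⟩ x hx
    rw [← h2 x]
    exact hc ⟨(y.1, x), ⟨h1, hx⟩, rfl⟩
  have hterm : ∀ (y : P), ∀ x ∈ tildeK a b Γ, ∀ j,
      0 ≤ MvPolynomial.eval x (gram p' (y.2.2 j)) * MvPolynomial.eval x (gPoly a b Γ j) :=
    fun y x hx j => mul_nonneg (eval_gram_nonneg _ _ _) (eval_gPoly_nonneg hx j)
  obtain ⟨r, hr⟩ := exists_norm_gram_le hlt hp (g := 1) one_ne_zero (by simp) c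
  choose r' hr' using fun j => exists_norm_gram_le hlt hp' (gPoly_ne_zero (Γ := Γ) hab h0 j)
    (fun x hx => eval_gPoly_nonneg hx j) c
  have hScompact : IsCompact S := by
    refine (hC.prod ((isCompact_closedBall (0 : Fin N → Fin N → ℝ) r).prod
      (isCompact_univ_pi fun j => isCompact_closedBall (0 : Fin N' → Fin N' → ℝ) (r' j)))
      ).of_isClosed_subset hSclosed ?_
    intro y hy
    refine ⟨hy.1, mem_closedBall_zero_iff.2 (hr _ fun x hx => ?_),
      fun j _ => mem_closedBall_zero_iff.2 (hr' j _ fun x hx => ?_)⟩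
    · rw [map_one, mul_one]
      have := Finset.sum_nonneg fun j (_ : j ∈ Finset.univ) => hterm y x hx j
      linarith [hle y hy x hx]
    · have := Finset.single_le_sum (fun j _ => hterm y x hx j) (Finset.mem_univ j)
      linarith [hle y hy x hx, eval_gram_nonneg p y.2.1 x]
  have hSsurj : ∀ w ∈ feasSOS a b Γ B d, 0 ≤ objective v w.1 → ∃ y ∈ S, F y = w := by
    intro w hw hw0
    obtain ⟨A, hA⟩ := (hpS _).1 hw.1
    choose A' hA' using fun j => (hpS' _).1 (hw.2.1 j)
    have hF : F (w.1, A, A') = w :=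
      Prod.ext rfl (Prod.ext hA.symm (funext fun j => (hA' j).symm))
    exact ⟨_, (hFS _).2 ⟨hF ▸ hw, hw0⟩, hF⟩
  obtain ⟨y0, hy0, -⟩ := hSsurj 0 (zero_mem_feasSOS d) objective_zero.ge
  obtain ⟨y, hy, hmax⟩ := hScompact.exists_isMaxOn ⟨y0, hy0⟩
    (f := fun y => objective v y.1) ((continuous_objective v).comp continuous_fst).continuousOn
  have hzero : objective v (0 : CutSOS Γ B).1 = 0 := objective_zero
  refine ⟨F y, mem_optimal_of_superlevel (x0 := 0) ?_ ?_⟩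
  · rw [hzero]
    exact (hFS y).1 hy
  · rw [hzero]
    rintro w ⟨hw, hw0⟩
    obtain ⟨y', hy', rfl⟩ := hSsurj w hw hw0
    exact hmax hy'

/-! ### Convergence as the degree bound grows -/

/-- Lowering `δ` slightly makes a feasible pair feasible for all large degree bounds. -/
theorem exists_mem_feasSOS (hab : ∀ i, a i < b i) (h0 : ∀ j, Γ.col j ≠ 0) {z : Cut Γ B}
    (hz : z ∈ feasTrunc a b Γ B) {ε : ℝ} (hε : 0 < ε) :
    ∃ d₀ : ℕ, ∀ d ≥ d₀, ∃ w ∈ feasSOS a b Γ B d, w.1 = (z.1, z.2 - ε) := by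
  have hlt : ∀ j, monoMin a b (Γ.col j) < monoMax a b (Γ.col j) :=
    fun j => monoMin_lt_monoMax hab (h0 j)
  obtain ⟨s, t, hs, ht, hst⟩ := mem_boxModule_of_pos hlt
    (f := pPoly z.1 - MvPolynomial.C (z.2 - ε)) (fun x hx => by
      have := hz.1 x hx
      simp only [map_sub, MvPolynomial.eval_C]
      linarith)
  refine ⟨max s.totalDegree (Finset.univ.sup fun j => (t j).totalDegree) + 2, fun d hd =>
    ⟨((z.1, z.2 - ε), s, t), ⟨⟨hs, ?_⟩, fun j => ⟨ht j, ?_⟩, hst, hz.2⟩, rfl⟩⟩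
  · have := le_max_left s.totalDegree (Finset.univ.sup fun j => (t j).totalDegree)
    change s.totalDegree ≤ d
    omega
  · have h1 := le_max_right s.totalDegree (Finset.univ.sup fun j => (t j).totalDegree)
    have h2 := Finset.le_sup (f := fun j => (t j).totalDegree) (Finset.mem_univ j)
    change (t j).totalDegree ≤ d - 2
    omega

/-- Almost maximizers in a compact set are close to the set of maximizers. -/
theorem tendsto_infDist_of_tendsto {α X : Type*} [PseudoMetricSpace X] {f : X → ℝ}
    (hf : Continuous f) {C O : Set X} (hC : IsCompact C) {m : ℝ}
    (hO : ∀ x ∈ C, m ≤ f x → x ∈ O) {l : Filter α} {u : α → X} (hu : ∀ᶠ i in l, u i ∈ C)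
    (hm : Tendsto (fun i => f (u i)) l (𝓝 m)) :
    Tendsto (fun i => Metric.infDist (u i) O) l (𝓝 0) := by
  rw [Metric.tendsto_nhds]
  intro ε hε
  have hdist : ∀ x, dist (Metric.infDist x O) 0 = Metric.infDist x O := fun x => by
    rw [Real.dist_0_eq_abs, abs_of_nonneg Metric.infDist_nonneg]
  simp only [hdist]
  have hC' : IsCompact (C ∩ {x | ε ≤ Metric.infDist x O}) :=
    hC.inter_right (isClosed_le continuous_const (Metric.continuous_infDist_pt O))
  rcases (C ∩ {x | ε ≤ Metric.infDist x O}).eq_empty_or_nonempty with hE | hE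
  · filter_upwards [hu] with i hi
    by_contra hlt
    exact hE.subset ⟨hi, not_lt.1 hlt⟩
  -- The maximum of `f` at distance at least `ε` from `O` is below `m`, so it is eventually exceeded
  -- by `f (u i)`.
  · obtain ⟨x, ⟨hxC, hx⟩, hmax⟩ := hC'.exists_isMaxOn hE hf.continuousOn
    have hxm : f x < m := by
      by_contra hge
      have hx' : ε ≤ Metric.infDist x O := hx
      rw [Metric.infDist_zero_of_mem (hO x hxC (not_lt.1 hge))] at hx'
      linarith
    filter_upwards [hu, hm.eventually (lt_mem_nhds hxm)] with i hi hfi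
    by_contra hlt
    exact absurd (hmax ⟨hi, not_lt.1 hlt⟩) (not_le.2 hfi)

theorem tendsto_objective_optSOS (hab : ∀ i, a i < b i) (h0 : ∀ j, Γ.col j ≠ 0)
    {l : Filter ℕ} (hl : l ≤ atTop) {w : ℕ → CutSOS Γ B}
    (hw : ∀ᶠ d in l, w d ∈ optSOS a b Γ B v d) {z : Cut Γ B} (hz : z ∈ optTrunc a b Γ B v) :
    Tendsto (fun d => objective v (w d).1) l (𝓝 (objective v z)) := by
  refine tendsto_order.2 ⟨fun m hm => ?_, fun m hm => ?_⟩
  -- Lowering `δ` by `ε` costs exactly `ε` in the objective; half the gap keeps the value above `m`.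
  · obtain ⟨d₀, hd₀⟩ := exists_mem_feasSOS hab h0 hz.1
      (ε := (objective v z - m) / 2) (by linarith)
    filter_upwards [hw, hl (eventually_ge_atTop d₀)] with d hd hdd
    obtain ⟨w', hw', e⟩ := hd₀ d hdd
    have h1 : objective v w'.1 ≤ objective v (w d).1 := hd.2 hw'
    have h2 : objective v w'.1 = objective v z - (objective v z - m) / 2 := by
      rw [e]
      simp only [objective]
      ring
    linarith
  · filter_upwards [hw] with d hd
    exact lt_of_le_of_lt (hz.2 (mem_feasTrunc_of_mem_feasSOS hd.1)) hm

end Problem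

end MonomialPattern

theorem mainTheorem9 {n k : ℕ} (hk : 1 ≤ k)
    (a b : Fin n → ℝ) (hab : ∀ i, a i < b i)
    (B : Finset (Fin n → ℕ)) (Γ : Matrix (Fin n) (Fin k) ℕ)
    (hB : ∀ j, Γ.col j ∈ B) (h0 : ∀ j, Γ.col j ≠ 0)
    (hdisj : Pairwise fun i j =>
      Disjoint (Function.support (Γ.col i)) (Function.support (Γ.col j)))
    (v : TS Γ B → ℝ) :
    -- (a) SOS-feasible solutions give feasible solutions
    (∀ d : ℕ, Even d → degSet (TS Γ B) ≤ d →
      ∀ w ∈ feasSOS a b Γ B d, w.1 ∈ feasTrunc a b Γ B) ∧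
    -- (b) optimal solutions exist, and converge as `d → ∞` along the even integers
    (optTrunc a b Γ B v).Nonempty ∧
    (∀ d : ℕ, Even d → degSet (TS Γ B) ≤ d → (optSOS a b Γ B v d).Nonempty) ∧
    (∀ w : ℕ → CutSOS Γ B,
      (∀ d : ℕ, Even d → degSet (TS Γ B) ≤ d → w d ∈ optSOS a b Γ B v d) →
      Tendsto (fun d => Metric.infDist (w d).1 (optTrunc a b Γ B v))
        (atTop ⊓ 𝓟 {d : ℕ | Even d}) (𝓝 0) ∧
      ∀ z ∈ optTrunc a b Γ B v,
        Tendsto (fun d => objective v (w d).1)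
          (atTop ⊓ 𝓟 {d : ℕ | Even d}) (𝓝 (objective v z))) := by
  refine ⟨fun d _ _ w hw => mem_feasTrunc_of_mem_feasSOS hw, optTrunc_nonempty hab h0,
    fun d _ _ => optSOS_nonempty hab h0 d, fun w hw => ?_⟩
  have hev : ∀ᶠ d in atTop ⊓ 𝓟 {d : ℕ | Even d}, w d ∈ optSOS a b Γ B v d := by
    filter_upwards [mem_inf_of_left (eventually_ge_atTop (degSet (TS Γ B))),
      mem_inf_of_right (mem_principal_self _)] with d hd he
    exact hw d he hd
  have hlim : ∀ z ∈ optTrunc a b Γ B v, Tendsto (fun d => objective v (w d).1)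
      (atTop ⊓ 𝓟 {d : ℕ | Even d}) (𝓝 (objective v z)) :=
    fun z hz => tendsto_objective_optSOS hab h0 inf_le_left hev hz
  refine ⟨?_, hlim⟩
  obtain ⟨z, hz⟩ := optTrunc_nonempty (B := B) (v := v) hab h0
  refine tendsto_infDist_of_tendsto (O := optTrunc a b Γ B v) (continuous_objective v)
    (isCompact_goodTrunc (v := v) hab h0) (fun x hx hxz => ⟨hx.1, fun y hy => ?_⟩) ?_ (hlim z hz)
  · exact le_trans (hz.2 hy) hxz
  -- Comparison with the zero solution places each optimal pair in the compact set.
  · filter_upwards [hev] with d hd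
    refine ⟨mem_feasTrunc_of_mem_feasSOS hd.1, ?_⟩
    have h1 : objective v (0 : CutSOS Γ B).1 ≤ objective v (w d).1 := hd.2 (zero_mem_feasSOS d)
    exact objective_zero.ge.trans h1
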